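/- Let $n\ge 3$. A convex body is a non-empty compact convex subset of $\mathbb R^n$; $[x,y]$ is the segment between $x$ and $y$, and $A-B=\{a-b: a\in A,\ b\in B\}$. For convex bodies $K,C\subset\mathbb R^n$, $C$ with non-empty interior, let $$R(K,C)=\min\{\lambda\ge 0: K\subseteq c+\lambda C\text{ for some }c\in\mathbb R^n\},\qquad D(K,C)=2\max\{R([x,y],C):x,y\in K\},$$ $$h(K,s)=\max\{s^{T}x:x\in K\},\qquad w(K,C)=\min_{s\in\mathbb R^n\setminus\{0\}}\frac{2h(K-K,s)}{h(C-C,s)}$$ be the circumradius, the diameter, the support function and the minimal width. $K$ is complete with respect to $C$ if $D(K',C)>D(K,C)$ for every convex body $K'\supsetneq K$, and it is of constant width with respect to $C$ if $w(K,C)=D(K,C)$. $C$ is called perfect if every convex body that is complete with respect to $C$ is of constant width with respect to $C$. An $n$-simplex is the convex hull of $n+1$ affinely independent points. **Corollary.** Let $n\ge 3$, let $C\subset\mathbb R^n$ be a convex body with non-empty interior and $C=-C$, and let $S\subset\mathbb R^n$ be an $n$-simplex such that $$S-S\subseteq D(S,C)\,C\subseteq (n+1)\bigl(S\cap(-S)\bigr).$$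 Then $C$ is not perfect. -/

import Mathlib

open scoped Pointwise

noncomputable section

namespace GenMinkowski

/-- The circumradius `R(K, C)`: the smallest `r ≥ 0` such that a translate of `r C` contains `K`. -/
def circumradius {n : ℕ} (K C : Set (EuclideanSpace ℝ (Fin n))) : ℝ :=
  sInf {r : ℝ | 0 ≤ r ∧ ∃ c : EuclideanSpace ℝ (Fin n), K ⊆ {c} + r • C}

/-- The diameter `D(K, C) = 2 max {R([x, y], C) : x, y ∈ K}`. -/
def diameter {n : ℕ} (K C : Set (EuclideanSpace ℝ (Fin n))) : ℝ :=
  2 * sSup {r : ℝ | ∃ x ∈ K, ∃ y ∈ K, r = circumradius (segment ℝ x y) C}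

/-- The support function `h(K, a) = max {aᵀ x : x ∈ K}`. -/
def supportFun {n : ℕ} (K : Set (EuclideanSpace ℝ (Fin n)))
    (a : EuclideanSpace ℝ (Fin n)) : ℝ :=
  sSup ((fun x => inner ℝ a x) '' K)

/-- The breadth `b_s(K, C) = 2 h(K - K, s) / h(C - C, s)` in the direction `s ≠ 0`. -/
def breadth {n : ℕ} (K C : Set (EuclideanSpace ℝ (Fin n)))
    (s : EuclideanSpace ℝ (Fin n)) : ℝ :=
  2 * supportFun (K - K) s / supportFun (C - C) s

/-- The minimal width `w(K, C)`: the minimum of `b_s(K, C)` over all directions `s ≠ 0`. -/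
def width {n : ℕ} (K C : Set (EuclideanSpace ℝ (Fin n))) : ℝ :=
  sInf {b : ℝ | ∃ s : EuclideanSpace ℝ (Fin n), s ≠ 0 ∧ b = breadth K C s}

/-- `K` is (diametrically) complete with respect to `C`: every convex body that properly
contains `K` has larger diameter. -/
def IsDiamComplete {n : ℕ} (K C : ConvexBody (EuclideanSpace ℝ (Fin n))) : Prop :=
  ∀ K' : ConvexBody (EuclideanSpace ℝ (Fin n)),
    (K : Set (EuclideanSpace ℝ (Fin n))) ⊂ (K' : Set (EuclideanSpace ℝ (Fin n))) →
      diameter (K : Set (EuclideanSpace ℝ (Fin n))) C <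
        diameter (K' : Set (EuclideanSpace ℝ (Fin n))) C

/-- `K` is of constant width with respect to `C`. -/
def IsConstantWidth {n : ℕ} (K C : ConvexBody (EuclideanSpace ℝ (Fin n))) : Prop :=
  width (K : Set (EuclideanSpace ℝ (Fin n))) C =
    diameter (K : Set (EuclideanSpace ℝ (Fin n))) C

/-- `C` is perfect: every convex body that is complete with respect to `C` is of constant width
with respect to `C`. -/
def IsPerfect {n : ℕ} (C : ConvexBody (EuclideanSpace ℝ (Fin n))) : Prop :=
  ∀ K : ConvexBody (EuclideanSpace ℝ (Fin n)), IsDiamComplete K C → IsConstantWidth K C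

/-- The convex hull of the `n + 1` affinely independent vertices of a simplex. -/
def simplexHull {n : ℕ} (S : Affine.Simplex ℝ (EuclideanSpace ℝ (Fin n)) n) :
    Set (EuclideanSpace ℝ (Fin n)) :=
  convexHull ℝ (Set.range S.points)

end GenMinkowski

end

open scoped Pointwise

namespace GenMinkowski

/-! Put B = D(S, C) C and suppose that C is perfect. The two inclusions together put the barycentre
of S at 0 and bound the linear part of every barycentric coordinate below by -1 on B
(`neg_one_le_coord_linear`), which makes S complete. By perfectness S has constant width, so no
linear functional is larger on B than on S - S (`IsConstantWidth.exists_le`); hence every partial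
sum of coordinates is at most 1 in absolute value on B.

Four vertices of S now yield a second complete body. The differences of the `tripod` points are
zero, edge vectors of S or averages of two of these, so they lie in B, and
`exists_convexBody_maximal` extends the tripod to a complete body M. Constant width of M would give
p, q in M at which the difference of the first two coordinates of p - q is at least 2, its value at
the edge e₀ - e₁. The bounds on partial sums, applied to p, q and the tripod points, exclude this
(`coord_sub_lt_two`). -/

variable {n : ℕ}

/-! ### Diameter and completeness in terms of difference vectors -/

/-- A segment whose difference vector lies in `r • C` is covered by a translate of
`(r / 2) • C`. -/
theorem exists_segment_subset {C : Set (EuclideanSpace ℝ (Fin n))} (hconv : Convex ℝ C)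
    (hneg : -C = C) {x y : EuclideanSpace ℝ (Fin n)} {r : ℝ} (h : x - y ∈ r • C) :
    ∃ c : EuclideanSpace ℝ (Fin n), segment ℝ x y ⊆ {c} + (r / 2) • C := by
  refine ⟨(1 / 2 : ℝ) • (x + y), ?_⟩
  obtain ⟨c, hc, hxy⟩ := h
  have hc' : -c ∈ C := by rw [← hneg]; simpa using hc
  rintro z ⟨a, b, ha, hb, hab, rfl⟩
  refine ⟨_, rfl, (r / 2) • (a • c + b • (-c)), ⟨_, hconv hc hc' ha hb hab, rfl⟩, ?_⟩
  have hx : x = y + r • c := by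
    have : r • c = x - y := hxy
    rw [this]; abel
  obtain rfl : a = 1 - b := by linarith
  subst hx
  simp only
  module

/-- A segment whose difference vector lies in `r • C` has circumradius at most `r / 2`. -/
theorem circumradius_segment_le {C : Set (EuclideanSpace ℝ (Fin n))} (hconv : Convex ℝ C)
    (hneg : -C = C) {x y : EuclideanSpace ℝ (Fin n)} {r : ℝ} (hr : 0 ≤ r) (h : x - y ∈ r • C) :
    circumradius (segment ℝ x y) C ≤ r / 2 :=
  csInf_le ⟨0, fun _ h => h.1⟩ ⟨by positivity, exists_segment_subset hconv hneg h⟩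

/-- The gauge of the difference of the endpoints is at most twice the circumradius. -/
theorem gauge_sub_le_two_mul_circumradius {C : Set (EuclideanSpace ℝ (Fin n))}
    (hconv : Convex ℝ C) (hneg : -C = C) {x y : EuclideanSpace ℝ (Fin n)} {r : ℝ} (hr : 0 ≤ r)
    (h : x - y ∈ r • C) : gauge C (x - y) ≤ 2 * circumradius (segment ℝ x y) C := by
  have key : gauge C (x - y) / 2 ≤ circumradius (segment ℝ x y) C := by
    refine le_csInf ?_ ?_
    · exact ⟨r / 2, by positivity, exists_segment_subset hconv hneg h⟩
    · rintro s ⟨hs, c, hsub⟩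
      obtain ⟨_, rfl, _, ⟨u, hu, rfl⟩, hux⟩ := hsub (left_mem_segment ℝ x y)
      obtain ⟨_, rfl, _, ⟨v, hv, rfl⟩, hvy⟩ := hsub (right_mem_segment ℝ x y)
      have hv' : -v ∈ C := by rw [← hneg]; simpa using hv
      -- By symmetry x - y = s(u - v) is 2s times a midpoint of two points of C.
      have hm : (1 / 2 : ℝ) • u + (1 / 2 : ℝ) • (-v) ∈ C :=
        hconv hu hv' (by norm_num) (by norm_num) (by norm_num)
      have : gauge C (x - y) ≤ 2 * s := by
        refine gauge_le_of_mem (by positivity) ⟨_, hm, ?_⟩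
        rw [← hux, ← hvy]
        simp only
        module
      linarith
  linarith

theorem diameter_le {K C : Set (EuclideanSpace ℝ (Fin n))} (hconv : Convex ℝ C)
    (hneg : -C = C) (hK : K.Nonempty) {r : ℝ} (hr : 0 ≤ r)
    (h : ∀ x ∈ K, ∀ y ∈ K, x - y ∈ r • C) : diameter K C ≤ r := by
  have : sSup {r : ℝ | ∃ x ∈ K, ∃ y ∈ K, r = circumradius (segment ℝ x y) C} ≤ r / 2 := by
    refine csSup_le ?_ ?_
    · obtain ⟨x, hx⟩ := hK
      exact ⟨_, x, hx, x, hx, rfl⟩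
    · rintro _ ⟨x, hx, y, hy, rfl⟩
      exact circumradius_segment_le hconv hneg hr (h x hx y hy)
  unfold diameter
  linarith

theorem diameter_nonneg (K C : Set (EuclideanSpace ℝ (Fin n))) : 0 ≤ diameter K C := by
  refine mul_nonneg zero_le_two (Real.sSup_nonneg ?_)
  rintro _ ⟨x, _, y, _, rfl⟩
  exact Real.sInf_nonneg fun _ h => h.1

/-- A bounded set of differences is contained in a multiple of a neighbourhood of `0`. -/
theorem exists_sub_mem_smul {K C : Set (EuclideanSpace ℝ (Fin n))} (hK : Bornology.IsBounded K)
    (h0 : C ∈ nhds (0 : EuclideanSpace ℝ (Fin n))) :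
    ∃ R : ℝ, 0 ≤ R ∧ ∀ x ∈ K, ∀ y ∈ K, x - y ∈ R • C := by
  have hb : Bornology.IsVonNBounded ℝ (K - K) :=
    (NormedSpace.isVonNBounded_iff ℝ).2 (hK.sub hK)
  obtain ⟨R, hR, h⟩ := (hb h0).exists_pos
  exact ⟨R, hR.le, fun x hx y hy =>
    h R (by rw [Real.norm_of_nonneg hR.le]) (Set.sub_mem_sub hx hy)⟩

theorem sub_mem_of_diameter_le {K C : Set (EuclideanSpace ℝ (Fin n))} (hconv : Convex ℝ C)
    (hneg : -C = C) (hclosed : IsClosed C) (h0 : C ∈ nhds (0 : EuclideanSpace ℝ (Fin n)))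
    (hK : Bornology.IsBounded K) {r : ℝ} (hr : 0 < r) (h : diameter K C ≤ r)
    {x y : EuclideanSpace ℝ (Fin n)} (hx : x ∈ K) (hy : y ∈ K) : x - y ∈ r • C := by
  -- A crude bound is needed first: `sInf` of an empty set and `sSup` of an unbounded one default to
  -- 0.
  obtain ⟨R, hR, hRC⟩ := exists_sub_mem_smul hK h0
  have h1 := gauge_sub_le_two_mul_circumradius hconv hneg hR (hRC x hx y hy)
  have h2 : circumradius (segment ℝ x y) C ≤
      sSup {r : ℝ | ∃ x ∈ K, ∃ y ∈ K, r = circumradius (segment ℝ x y) C} := by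
    refine le_csSup ⟨R / 2, ?_⟩ ⟨x, hx, y, hy, rfl⟩
    rintro _ ⟨x, hx, y, hy, rfl⟩
    exact circumradius_segment_le hconv hneg hR (hRC x hx y hy)
  have h3 : gauge C (x - y) ≤ r := by
    unfold diameter at h
    linarith
  have h4 : gauge C (r⁻¹ • (x - y)) ≤ 1 := by
    rw [gauge_smul_of_nonneg (by positivity), smul_eq_mul, inv_mul_le_iff₀ hr]
    linarith
  rw [Set.mem_smul_set_iff_inv_smul_mem₀ hr.ne']
  have := mem_closure_of_gauge_le_one hconv (mem_of_mem_nhds h0) (absorbent_nhds_zero h0) h4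
  rwa [hclosed.closure_eq] at this

/-- In a larger body of diameter at most r, every point differs from each point of M by an element
of r C, so the maximality hypothesis already puts it in M. -/
theorem isDiamComplete_of_forall_sub_mem {M C : ConvexBody (EuclideanSpace ℝ (Fin n))}
    (hneg : -(C : Set (EuclideanSpace ℝ (Fin n))) = C)
    (h0 : (C : Set (EuclideanSpace ℝ (Fin n))) ∈ nhds 0) {r : ℝ} (hr : 0 < r)
    (hM : diameter (M : Set (EuclideanSpace ℝ (Fin n))) C = r)
    (h : ∀ y, (∀ x ∈ M, y - x ∈ r • (C : Set (EuclideanSpace ℝ (Fin n)))) → y ∈ M) :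
    IsDiamComplete M C := by
  intro K' hK'
  by_contra! hle
  rw [hM] at hle
  refine hK'.2 fun y hy => h y fun x hx => ?_
  exact sub_mem_of_diameter_le C.convex hneg C.isCompact.isClosed h0 K'.isCompact.isBounded hr hle
    hy (hK'.1 hx)

/-! ### Support functions and constant width -/

theorem isCompact_sub {K L : Set (EuclideanSpace ℝ (Fin n))} (hK : IsCompact K)
    (hL : IsCompact L) : IsCompact (K - L) := by
  rw [sub_eq_add_neg]
  exact hK.add hL.neg

theorem bddAbove_inner_image {K : Set (EuclideanSpace ℝ (Fin n))} (hK : IsCompact K)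
    (s : EuclideanSpace ℝ (Fin n)) : BddAbove ((fun x => inner ℝ s x) '' K) :=
  (hK.image (by fun_prop)).bddAbove

theorem supportFun_sub_nonneg (K : ConvexBody (EuclideanSpace ℝ (Fin n)))
    (s : EuclideanSpace ℝ (Fin n)) :
    0 ≤ supportFun ((K : Set (EuclideanSpace ℝ (Fin n))) - (K : Set (EuclideanSpace ℝ (Fin n)))) s := by
  obtain ⟨x, hx⟩ := K.nonempty
  refine le_csSup (bddAbove_inner_image (isCompact_sub K.isCompact K.isCompact) s) ⟨x - x, ?_, by simp⟩
  exact Set.sub_mem_sub hx hx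

/-- If `M` has constant width `r`, then no linear functional is larger on `r • C` than on
`M - M`. -/
theorem IsConstantWidth.exists_le {M C : ConvexBody (EuclideanSpace ℝ (Fin n))}
    (hw : IsConstantWidth M C) (hneg : -(C : Set (EuclideanSpace ℝ (Fin n))) = C) {r : ℝ} (hr : 0 < r)
    (hM : diameter (M : Set (EuclideanSpace ℝ (Fin n))) C = r)
    (f : EuclideanSpace ℝ (Fin n) →ₗ[ℝ] ℝ) {x : EuclideanSpace ℝ (Fin n)}
    (hx : x ∈ r • (C : Set (EuclideanSpace ℝ (Fin n)))) :
    ∃ p ∈ M, ∃ q ∈ M, f x ≤ f (p - q) := by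
  set s := (InnerProductSpace.toDual ℝ (EuclideanSpace ℝ (Fin n))).symm f.toContinuousLinearMap
    with hs_def
  have hs (y) : inner ℝ s y = f y := by simp [hs_def]
  have hcomp : IsCompact ((M : Set (EuclideanSpace ℝ (Fin n))) - (M : Set (EuclideanSpace ℝ (Fin n)))) :=
    isCompact_sub M.isCompact M.isCompact
  by_cases hs0 : s = 0
  · obtain ⟨p, hp⟩ := M.nonempty
    refine ⟨p, hp, p, hp, ?_⟩
    rw [← hs, ← hs, hs0]
    simp
  have hle : r ≤ breadth (M : Set (EuclideanSpace ℝ (Fin n))) C s := by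
    rw [← hM, ← hw]
    refine csInf_le ⟨0, ?_⟩ ⟨s, hs0, rfl⟩
    rintro _ ⟨t, _, rfl⟩
    exact div_nonneg (mul_nonneg zero_le_two (supportFun_sub_nonneg M t))
      (supportFun_sub_nonneg C t)
  -- A zero denominator would make the breadth 0 by the division convention, below r > 0.
  have hCpos : 0 < supportFun ((C : Set (EuclideanSpace ℝ (Fin n))) - (C : Set (EuclideanSpace ℝ (Fin n)))) s := by
    refine (supportFun_sub_nonneg C s).lt_of_ne' fun h => ?_
    rw [breadth, h, div_zero] at hle
    linarith
  rw [breadth, le_div_iff₀ hCpos] at hle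
  obtain ⟨c, hc, rfl⟩ := hx
  have hc' : -c ∈ (C : Set (EuclideanSpace ℝ (Fin n))) := by rw [← hneg]; simpa using hc
  have h1 : 2 * f c ≤ supportFun ((C : Set (EuclideanSpace ℝ (Fin n))) - (C : Set (EuclideanSpace ℝ (Fin n)))) s := by
    refine le_csSup (bddAbove_inner_image (isCompact_sub C.isCompact C.isCompact) s)
      ⟨c - -c, Set.sub_mem_sub hc hc', ?_⟩
    simp only [hs, map_sub, map_neg]
    ring
  obtain ⟨z, hz, hzs⟩ := (hcomp.image (f := fun x => inner ℝ s x) (by fun_prop)).sSup_mem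
    ((M.nonempty.sub M.nonempty).image _)
  obtain ⟨p, hp, q, hq, rfl⟩ := hz
  refine ⟨p, hp, q, hq, ?_⟩
  have h2 : f (p - q) = supportFun ((M : Set (EuclideanSpace ℝ (Fin n))) - (M : Set (EuclideanSpace ℝ (Fin n)))) s :=
    (hs _).symm.trans hzs
  rw [h2]
  simp only [map_smul, smul_eq_mul]
  nlinarith [mul_le_mul_of_nonneg_left h1 hr.le]

/-! ### Completions by Zorn's lemma -/

/-- Every set whose differences lie in `B` is contained in a maximal one. -/
theorem exists_maximal_sub_mem {E : Type*} [AddCommGroup E] {B : Set E} (hneg : -B = B)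
    (h0 : (0 : E) ∈ B) {K : Set E} (hK : ∀ x ∈ K, ∀ y ∈ K, x - y ∈ B) :
    ∃ M, K ⊆ M ∧ (∀ x ∈ M, ∀ y ∈ M, x - y ∈ B) ∧ ∀ y, (∀ x ∈ M, y - x ∈ B) → y ∈ M := by
  obtain ⟨M, hKM, hM⟩ := zorn_subset_nonempty {K : Set E | ∀ x ∈ K, ∀ y ∈ K, x - y ∈ B} (by
    intro c hc hchain _
    refine ⟨⋃₀ c, ?_, fun s hs => Set.subset_sUnion_of_mem hs⟩
    rintro x ⟨s, hs, hxs⟩ y ⟨t, ht, hyt⟩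
    rcases hchain.total hs ht with h | h
    · exact hc ht x (h hxs) y hyt
    · exact hc hs x hxs y (h hyt)) K hK
  refine ⟨M, hKM, hM.prop, fun y hy => ?_⟩
  have hsymm : ∀ x ∈ M, x - y ∈ B := fun x hx => by
    rw [← hneg, Set.mem_neg, neg_sub]
    exact hy x hx
  have hins : insert y M ∈ {K : Set E | ∀ x ∈ K, ∀ y ∈ K, x - y ∈ B} := by
    rintro a (rfl | ha) b (rfl | hb)
    · simpa using h0
    · exact hy b hb
    · exact hsymm a ha
    · exact hM.prop a ha b hb
  exact hM.le_of_ge hins (Set.subset_insert y M) (Set.mem_insert y M)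

/-- Every set of diameter at most `r` is contained in a complete convex body whose differences
lie in `r • C`. -/
theorem exists_convexBody_maximal {C : ConvexBody (EuclideanSpace ℝ (Fin n))}
    (hneg : -(C : Set (EuclideanSpace ℝ (Fin n))) = C) (h0 : (0 : EuclideanSpace ℝ (Fin n)) ∈ C)
    (r : ℝ) {K : Set (EuclideanSpace ℝ (Fin n))} (hne : K.Nonempty)
    (hK : ∀ x ∈ K, ∀ y ∈ K, x - y ∈ r • (C : Set (EuclideanSpace ℝ (Fin n)))) :
    ∃ M : ConvexBody (EuclideanSpace ℝ (Fin n)), K ⊆ M ∧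
      (∀ x ∈ M, ∀ y ∈ M, x - y ∈ r • (C : Set (EuclideanSpace ℝ (Fin n)))) ∧
      ∀ y, (∀ x ∈ M, y - x ∈ r • (C : Set (EuclideanSpace ℝ (Fin n)))) → y ∈ M := by
  set B := r • (C : Set (EuclideanSpace ℝ (Fin n))) with hB
  have hBconv : Convex ℝ B := C.convex.smul r
  have hBcomp : IsCompact B := C.isCompact.smul r
  have hBneg : -B = B := by rw [hB, ← Set.smul_set_neg, hneg]
  obtain ⟨M, hKM, hM, hmax⟩ := exists_maximal_sub_mem hBneg ⟨0, h0, smul_zero r⟩ hK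
  -- Maximality makes M the intersection of the translates x + B over x in M, so M inherits
  -- closedness from B.
  have hMeq : M = ⋂ x ∈ M, (fun y => y - x) ⁻¹' B := by
    ext y
    simp only [Set.mem_iInter, Set.mem_preimage]
    exact ⟨fun hy x hx => hM y hy x hx, fun h => hmax y h⟩
  have hMclosed : IsClosed M := by
    rw [hMeq]
    exact isClosed_biInter fun x _ => hBcomp.isClosed.preimage (by fun_prop)
  have hMconv : Convex ℝ M := by
    intro y hy z hz a b ha hb hab
    refine hmax _ fun x hx => ?_
    have : a • y + b • z - x = a • (y - x) + b • (z - x) := by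
      obtain rfl : a = 1 - b := by linarith
      module
    rw [this]
    exact hBconv (hM y hy x hx) (hM z hz x hx) ha hb hab
  obtain ⟨k, hk⟩ := hne
  have hMcomp : IsCompact M := by
    refine (hBcomp.image (f := fun y => y + k) (by fun_prop)).of_isClosed_subset hMclosed ?_
    intro y hy
    exact ⟨y - k, hM y hy k (hKM hk), by simp⟩
  exact ⟨⟨M, hMconv, hMcomp, ⟨k, hKM hk⟩⟩, hKM, hM, hmax⟩

/-! ### Barycentric coordinates of a simplex -/

section Simplex

variable {E ι : Type*} [AddCommGroup E] [Module ℝ E] (b : AffineBasis ι ℝ E)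

theorem coord_linear_sub (i : ι) (x y : E) :
    (b.coord i).linear (x - y) = b.coord i x - b.coord i y :=
  (b.coord i).linearMap_vsub x y

theorem coord_linear_basis_sub [DecidableEq ι] (i j k : ι) :
    (b.coord i).linear (b j - b k) = (if i = j then 1 else 0) - (if i = k then 1 else 0) := by
  rw [coord_linear_sub, b.coord_apply, b.coord_apply]

/-- A multiple of a simplex with `N` vertices that contains the difference body forces each
barycentric coordinate to be bounded below by `-1`. -/
theorem neg_one_le_coord_linear [DecidableEq ι] [Fintype ι] {B : Set E} {N : ℝ} (hN : N = Fintype.card ι)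
    (h₁ : ∀ i j, b i - b j ∈ B)
    (h₂ : ∀ x ∈ B, ∃ y, (∀ i, 0 ≤ b.coord i y) ∧ N • y = x)
    {x : E} (hx : x ∈ B) (i : ι) : -1 ≤ (b.coord i).linear x := by
  have hcoord (i : ι) (y : E) : N * b.coord i y = (b.coord i).linear (N • y) + N * b.coord i 0 := by
    have h : (b.coord i).linear y = b.coord i y - b.coord i 0 := by
      simpa using coord_linear_sub b i y 0
    rw [map_smul, h, smul_eq_mul]
    ring
  have hcard : 0 < Fintype.card ι := Fintype.card_pos_iff.2 ⟨i⟩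
  have hN0 : 0 < N := by rw [hN]; exact_mod_cast hcard
  have hlower (z : E) (hz : z ∈ B) (j : ι) : 0 ≤ (b.coord j).linear z + N * b.coord j 0 := by
    obtain ⟨y, hy, rfl⟩ := h₂ z hz
    rw [← hcoord]
    exact mul_nonneg hN0.le (hy j)
  by_cases hsub : ∃ k, k ≠ i
  -- The j-th coordinate of an edge vector `b l - b j` is -1, which gives this bound. The N numbers
  -- `N * b.coord j 0` add up to N, so all equal 1: the barycentre is 0.
  · have hge (j : ι) : 1 ≤ N * b.coord j 0 := by
      obtain ⟨l, hl⟩ : ∃ l, l ≠ j := by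
        obtain ⟨k, hk⟩ := hsub
        by_cases hj : j = i
        · exact ⟨k, hj ▸ hk⟩
        · exact ⟨i, Ne.symm hj⟩
      have := hlower _ (h₁ l j) j
      rw [coord_linear_basis_sub, if_neg hl.symm, if_pos rfl] at this
      linarith
    have hsum : ∑ j, (N * b.coord j 0 - 1) = 0 := by
      rw [Finset.sum_sub_distrib, ← Finset.mul_sum, b.sum_coord_apply_eq_one]
      simp [hN]
    have h0 := (Finset.sum_eq_zero_iff_of_nonneg fun j _ => sub_nonneg.2 (hge j)).1 hsum i
      (Finset.mem_univ i)
    linarith [hlower x hx i]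
  · push Not at hsub
    have : Subsingleton ι := ⟨fun a c => (hsub a).trans (hsub c).symm⟩
    have h0 : b.coord i 0 = 1 := by
      have := b.sum_coord_apply_eq_one (0 : E)
      rwa [Fintype.sum_subsingleton _ i] at this
    have h1 : N = 1 := by
      rw [hN, Fintype.card_eq_one_iff.2 ⟨i, hsub⟩]
      norm_num
    have := hlower x hx i
    rw [h0, h1] at this
    linarith

/-- Differences of points of a simplex have coordinate sums at most `1`. -/
theorem sum_coord_linear_sub_le [Fintype ι] {p q : E} (hp : ∀ i, 0 ≤ b.coord i p)
    (hq : ∀ i, 0 ≤ b.coord i q) (I : Finset ι) :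
    (∑ i ∈ I, (b.coord i).linear) (p - q) ≤ 1 := by
  simp only [LinearMap.sum_apply, coord_linear_sub, Finset.sum_sub_distrib]
  have h1 : ∑ i ∈ I, b.coord i p ≤ ∑ i, b.coord i p :=
    Finset.sum_le_univ_sum_of_nonneg hp
  rw [b.sum_coord_apply_eq_one] at h1
  linarith [Finset.sum_nonneg fun i (_ : i ∈ I) => hq i]

end Simplex

/-! ### The tripod -/

/-- The four points `0`, `(e₀ + e₁ - e₂ - e₃) / 2`, `(e₀ - e₁ + e₂ - e₃) / 2` and
`(e₀ - e₁ - e₂ + e₃) / 2`. -/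
def tripod {E : Type*} [AddCommGroup E] [Module ℝ E] (e₀ e₁ e₂ e₃ : E) : Set E :=
  {0, (1 / 2 : ℝ) • (e₀ - e₂) + (1 / 2 : ℝ) • (e₁ - e₃),
    (1 / 2 : ℝ) • (e₀ - e₁) + (1 / 2 : ℝ) • (e₂ - e₃),
    (1 / 2 : ℝ) • (e₀ - e₁) + (1 / 2 : ℝ) • (e₃ - e₂)}

/-- Each difference is zero, a single e i - e j, or the average of two such vectors. -/
theorem tripod_sub_mem {E : Type*} [AddCommGroup E] [Module ℝ E] {B : Set E} (hB : Convex ℝ B)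
    {e : Fin 4 → E} (he : ∀ i j, e i - e j ∈ B) {x y : E}
    (hx : x ∈ tripod (e 0) (e 1) (e 2) (e 3)) (hy : y ∈ tripod (e 0) (e 1) (e 2) (e 3)) :
    x - y ∈ B := by
  have hcomb (i j k l : Fin 4) :
      (1 / 2 : ℝ) • (e i - e j) + (1 / 2 : ℝ) • (e k - e l) ∈ B :=
    hB (he i j) (he k l) (by norm_num) (by norm_num) (by norm_num)
  rcases hx with rfl | rfl | rfl | rfl <;> rcases hy with rfl | rfl | rfl | rfl
  · convert he 0 0 using 1; module
  · convert hcomb 2 0 3 1 using 1; module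
  · convert hcomb 1 0 3 2 using 1; module
  · convert hcomb 1 0 2 3 using 1; module
  · convert hcomb 0 2 1 3 using 1; module
  · convert he 0 0 using 1; module
  · convert he 1 2 using 1; module
  · convert he 1 3 using 1; module
  · convert hcomb 0 1 2 3 using 1; module
  · convert he 2 1 using 1; module
  · convert he 0 0 using 1; module
  · convert he 2 3 using 1; module
  · convert hcomb 0 1 3 2 using 1; module
  · convert he 3 1 using 1; module
  · convert he 3 2 using 1; module
  · convert he 0 0 using 1; module

/-- A set that contains the tripod and whose differences have coordinate sums at most `1` does
not contain two points with difference `e₀ - e₁`. -/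
theorem coord_sub_lt_two {E : Type*} [AddCommGroup E] [Module ℝ E] {B M : Set E} {e : Fin 4 → E}
    (β : Fin 3 → E →ₗ[ℝ] ℝ)
    (hβ : ∀ i j k, β i (e j - e k) =
      (if i.castSucc = j then 1 else 0) - (if i.castSucc = k then 1 else 0))
    (hB : ∀ I : Finset (Fin 3), ∀ x ∈ B, |(∑ i ∈ I, β i) x| ≤ 1)
    (hK : tripod (e 0) (e 1) (e 2) (e 3) ⊆ M) (hM : ∀ x ∈ M, ∀ y ∈ M, x - y ∈ B)
    {p q : E} (hp : p ∈ M) (hq : q ∈ M) : (β 0 - β 1) (p - q) < 2 := by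
  have h1 (i : Fin 3) (x : E) (hx : x ∈ B) : |β i x| ≤ 1 := by
    simpa using hB {i} x hx
  have h2 (i j : Fin 3) (hij : i ≠ j) (x : E) (hx : x ∈ B) : |β i x + β j x| ≤ 1 := by
    simpa [Finset.sum_pair hij] using hB {i, j} x hx
  have hpq := hM p hp q hq
  have hp0 : p ∈ B := by simpa using hM p hp 0 (hK (by simp [tripod]))
  have hpA := hM p hp _ (hK (Or.inr (Or.inl rfl)))
  have hqB := hM q hq _ (hK (Or.inr (Or.inr (Or.inl rfl))))
  have hqG := hM q hq _ (hK (Or.inr (Or.inr (Or.inr rfl))))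
  have f1 := abs_le.1 (h1 0 _ hpq)
  have f2 := abs_le.1 (h1 1 _ hpq)
  have f3 := abs_le.1 (h2 0 2 (by decide) _ hpq)
  have f4 := abs_le.1 (h2 1 2 (by decide) _ hpq)
  have f5 := abs_le.1 (h1 0 _ hp0)
  have f6 := abs_le.1 (h2 0 2 (by decide) _ hp0)
  have f7 := abs_le.1 (h2 1 2 (by decide) _ hp0)
  have f8 := abs_le.1 (h2 0 2 (by decide) _ hqB)
  have f9 := abs_le.1 (h2 1 2 (by decide) _ hqG)
  have f10 := abs_le.1 (h1 1 _ hpA)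
  rw [map_sub (β _), map_add (β _), map_smul, map_smul, hβ, hβ] at f10
  rw [map_sub (β 0), map_sub (β 2), map_add (β 0), map_add (β 2)] at f8
  rw [map_sub (β 1), map_sub (β 2), map_add (β 1), map_add (β 2)] at f9
  simp only [map_smul, hβ, smul_eq_mul] at f8 f9 f10
  simp [Fin.ext_iff] at f8 f9 f10
  rw [map_sub] at f1 f2
  simp only [map_sub] at f3 f4
  rw [LinearMap.sub_apply, map_sub, map_sub]
  -- The value 2 forces `β 0`, `β 1`, `β 2` to be 1, -1, 0 at p - q. Comparing q with the last two
  -- tripod points then gives β₀ + β₂ ≥ 1 and β₁ + β₂ ≤ -1 at p. As β₀ ≤ 1 there, β₂ ≥ 0 and β₁ ≤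
  -- -1, whereas the second tripod point requires β₁ ≥ -1/2.
  by_contra! hcon
  linarith

end GenMinkowski

/-! ### The main theorem -/

theorem mainTheorem6 (n : ℕ) (hn : 3 ≤ n)
    (C : ConvexBody (EuclideanSpace ℝ (Fin n)))
    (hC : -(C : Set (EuclideanSpace ℝ (Fin n))) = C)
    (S : Affine.Simplex ℝ (EuclideanSpace ℝ (Fin n)) n)
    (h₁ : GenMinkowski.simplexHull S - GenMinkowski.simplexHull S ⊆
      GenMinkowski.diameter (GenMinkowski.simplexHull S) C •
        (C : Set (EuclideanSpace ℝ (Fin n))))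
    (h₂ : GenMinkowski.diameter (GenMinkowski.simplexHull S) C •
        (C : Set (EuclideanSpace ℝ (Fin n))) ⊆
      ((n : ℝ) + 1) • (GenMinkowski.simplexHull S ∩ -GenMinkowski.simplexHull S)) :
    ¬ GenMinkowski.IsPerfect C := by
  classical
  open GenMinkowski in
  intro hperf
  have hspan : affineSpan ℝ (Set.range S.points) = ⊤ :=
    S.independent.affineSpan_eq_top_iff_card_eq_finrank_add_one.2 (by simp)
  set b : AffineBasis (Fin (n + 1)) ℝ (EuclideanSpace ℝ (Fin n)) :=
    ⟨S.points, S.independent, hspan⟩ with hb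
  have hS : simplexHull S = {x | ∀ i, 0 ≤ b.coord i x} := b.convexHull_eq_nonneg_coord
  have hvert (i) : b i ∈ simplexHull S := subset_convexHull ℝ _ ⟨i, rfl⟩
  obtain ⟨z, hz⟩ := interior_convexHull_nonempty_iff_affineSpan_eq_top.2 hspan
  set r := diameter (simplexHull S) C with hr_def
  have hr0 : 0 ≤ r := diameter_nonneg _ _
  -- S - z is a neighbourhood of 0 contained in S - S, hence in r C; this also yields the non-empty
  -- interior of C.
  have hBnhds : r • (C : Set (EuclideanSpace ℝ (Fin n))) ∈ nhds 0 := by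
    have hcont : Filter.Tendsto (fun x => x + z) (nhds 0) (nhds z) := by
      have : Continuous fun x : EuclideanSpace ℝ (Fin n) => x + z := by fun_prop
      simpa using this.tendsto 0
    filter_upwards [hcont (mem_interior_iff_mem_nhds.1 hz)] with x hx
    exact h₁ ⟨x + z, hx, z, interior_subset hz, by simp⟩
  have hr : 0 < r := by
    refine hr0.lt_of_ne fun h => ?_
    have h01 : b ⟨0, by omega⟩ - b ⟨1, by omega⟩ ∈ r • (C : Set (EuclideanSpace ℝ (Fin n))) :=
      h₁ (Set.sub_mem_sub (hvert _) (hvert _))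
    rw [← h, Set.zero_smul_set C.nonempty] at h01
    have : (⟨0, by omega⟩ : Fin (n + 1)) = ⟨1, by omega⟩ := b.ind.injective (sub_eq_zero.1 h01)
    simp at this
  have hCnhds : (C : Set (EuclideanSpace ℝ (Fin n))) ∈ nhds 0 :=
    (set_smul_mem_nhds_zero_iff hr.ne').1 hBnhds
  have hBneg {x} (hx : x ∈ r • (C : Set (EuclideanSpace ℝ (Fin n)))) :
      -x ∈ r • (C : Set (EuclideanSpace ℝ (Fin n))) := by
    rwa [← Set.mem_neg, ← Set.smul_set_neg, hC]
  have hdiff (i j) : b i - b j ∈ r • (C : Set (EuclideanSpace ℝ (Fin n))) :=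
    h₁ (Set.sub_mem_sub (hvert i) (hvert j))
  -- The simplex is complete.
  let T : ConvexBody (EuclideanSpace ℝ (Fin n)) :=
    ⟨simplexHull S, convex_convexHull ℝ _, (Set.finite_range S.points).isCompact_convexHull ℝ,
      ⟨_, hvert 0⟩⟩
  have hlower {x} (hx : x ∈ r • (C : Set (EuclideanSpace ℝ (Fin n)))) (i) :
      -1 ≤ (b.coord i).linear x := by
    refine neg_one_le_coord_linear b (N := (n : ℝ) + 1) (by simp) hdiff (fun x hx => ?_) hx i
    obtain ⟨y, hy, rfl⟩ := h₂ hx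
    have := hy.1
    rw [hS] at this
    exact ⟨y, this, rfl⟩
  have hTcomplete : IsDiamComplete T C := by
    refine isDiamComplete_of_forall_sub_mem hC hCnhds hr rfl fun y hy => ?_
    change y ∈ simplexHull S
    rw [hS]
    intro i
    have := hlower (hy (b i) (hvert i)) i
    rw [coord_linear_sub, b.coord_apply_eq] at this
    linarith
  -- If the simplex has constant width, then coordinate sums on `r • C` are at most `1`.
  have hsum (I : Finset (Fin (n + 1))) {x}
      (hx : x ∈ r • (C : Set (EuclideanSpace ℝ (Fin n)))) :
      |(∑ i ∈ I, (b.coord i).linear) x| ≤ 1 := by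
    have hle {x} (hx : x ∈ r • (C : Set (EuclideanSpace ℝ (Fin n)))) :
        (∑ i ∈ I, (b.coord i).linear) x ≤ 1 := by
      obtain ⟨p, hp, q, hq, h⟩ := (hperf T hTcomplete).exists_le hC hr rfl
        (∑ i ∈ I, (b.coord i).linear) hx
      replace hp : p ∈ simplexHull S := hp
      replace hq : q ∈ simplexHull S := hq
      rw [hS] at hp hq
      exact h.trans (sum_coord_linear_sub_le b hp hq I)
    have := hle (hBneg hx)
    rw [map_neg] at this
    exact abs_le.2 ⟨by linarith, hle hx⟩
  -- The completion of the tripod does not have constant width.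
  let ψ : Fin 4 ↪ Fin (n + 1) := Fin.castLEEmb (by omega)
  let e : Fin 4 → EuclideanSpace ℝ (Fin n) := fun j => b (ψ j)
  let β : Fin 3 → EuclideanSpace ℝ (Fin n) →ₗ[ℝ] ℝ := fun i => (b.coord (ψ i.castSucc)).linear
  have hβ (i j k) : β i (e j - e k) =
      (if i.castSucc = j then 1 else 0) - (if i.castSucc = k then 1 else 0) := by
    simp only [β, e, coord_linear_basis_sub, ψ.injective.eq_iff]
  have he (i j) : e i - e j ∈ r • (C : Set (EuclideanSpace ℝ (Fin n))) := hdiff _ _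
  have hBsum (I : Finset (Fin 3)) (x) (hx : x ∈ r • (C : Set (EuclideanSpace ℝ (Fin n)))) :
      |(∑ i ∈ I, β i) x| ≤ 1 := by
    have := hsum (I.map (Fin.castSuccEmb.trans ψ)) hx
    rwa [Finset.sum_map] at this
  obtain ⟨M, hKM, hM, hmax⟩ := exists_convexBody_maximal hC (mem_of_mem_nhds hCnhds) r
    ⟨0, Or.inl rfl⟩ fun x hx y hy => tripod_sub_mem (C.convex.smul r) he hx hy
  have hMdiam : diameter (M : Set (EuclideanSpace ℝ (Fin n))) C = r := by
    refine le_antisymm (diameter_le C.convex hC M.nonempty hr0 hM) ?_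
    -- Two tripod points differ by e₁ - e₃, where `β 1` attains its bound 1 on r C, so this vector
    -- lies in no smaller multiple of C. The radius (d + r) / 2 lies strictly between d and r and is
    -- positive even if d = 0.
    by_contra! hlt
    set d := diameter (M : Set (EuclideanSpace ℝ (Fin n))) C
    have hd : 0 ≤ d := diameter_nonneg _ _
    obtain ⟨c, hc, hce⟩ := sub_mem_of_diameter_le (r := (d + r) / 2) C.convex hC
      C.isCompact.isClosed hCnhds M.isCompact.isBounded (by linarith) (by linarith)
      (hKM (Or.inr (Or.inl rfl))) (hKM (Or.inr (Or.inr (Or.inr rfl))))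
    have h1 : ((d + r) / 2) * β 1 c = 1 := by
      rw [← smul_eq_mul, ← map_smul]
      have hk (a₀ a₁ a₂ a₃ : EuclideanSpace ℝ (Fin n)) :
          (1 / 2 : ℝ) • (a₀ - a₂) + (1 / 2 : ℝ) • (a₁ - a₃) -
            ((1 / 2 : ℝ) • (a₀ - a₁) + (1 / 2 : ℝ) • (a₃ - a₂)) = a₁ - a₃ := by module
      refine (congrArg (β 1) (hce.trans (hk _ _ _ _))).trans ?_
      rw [hβ]
      simp
    have h2 : r * β 1 c ≤ 1 := by
      have := (abs_le.1 (hBsum {1} (r • c) ⟨c, hc, rfl⟩)).2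
      simpa using this
    have h3 : 0 < β 1 c := pos_of_mul_pos_right (h1 ▸ one_pos) (by linarith)
    nlinarith
  obtain ⟨p, hp, q, hq, hpq⟩ :=
    (hperf M (isDiamComplete_of_forall_sub_mem hC hCnhds hr hMdiam hmax)).exists_le hC hr
      hMdiam (β 0 - β 1) (he 0 1)
  refine (coord_sub_lt_two β hβ hBsum hKM hM hp hq).not_ge (hpq.trans' ?_)
  simp only [LinearMap.sub_apply, hβ]
  simp
  norm_num
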